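/- Let $(c_n)_{n\ge 1}$ be a sequence of points of $\mathbb R^3$ and $(r_n)_{n\ge1}$ a sequence of positive numbers. The closed balls $\overline B(c_n,r_n)$ form a \emph{configuration of balls} if they are pairwise disjoint and $\Omega=\mathbb R^3\setminus\bigcup_{n}\overline B(c_n,r_n)$ is a region (open and connected) containing $0$. The configuration is \emph{separated} if there is $\epsilon>0$ with $|c_n-c_m|\ge 2\epsilon$ for all $n\ne m$, and \emph{avoidable} if, with positive probability, Brownian motion in $\mathbb R^3$ starting from $0$ never hits any of the balls. For integers $m\ge 0$ and $k\ge 1$, a \emph{string} of $2k$ balls is the family of closed balls of radius $1/4$ centred at the points $(m+i,0,0)$, $i=1,\dots,2k$, of the $x_1$-axis. \textbf{Proposition.} There is an avoidable, separated configuration of balls $\overline B(c_n,r_n)$, $n\ge1$, in $\mathbb R^3$ for which $$\sum_{n=1}^\infty \frac{r_n}{|c_n|}=\infty .$$ Moreover, the balls can be taken to be a union of strings: $r_n=1/4$ for all $n$, and there are integers $m_j\ge 0$ and $k_j\ge1$ $(j\ge 0)$ with $m_j+2k_j<m_{j+1}$ such that $$\{c_n : n\ge 1\}=\bigcup_{j\ge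 0}\{(m_j+i,0,0): 1\le i\le 2k_j\}.$$ -/

import Mathlib

open MeasureTheory ProbabilityTheory Filter
open scoped NNReal

universe u

/-- Standard Brownian motion in `ℝᵈ` started at the origin: its coordinates are independent
real Brownian motions (each with almost surely continuous paths). -/
structure IsBrownianMotion {d : ℕ} {Ω : Type u} [MeasurableSpace Ω]
    (W : ℝ≥0 → Ω → EuclideanSpace ℝ (Fin d)) (P : Measure Ω) : Prop where
  coord : ∀ i : Fin d, IsBrownianReal (fun t ω => W t ω i) P
  indep : iIndepFun (fun (i : Fin d) (ω : Ω) (t : ℝ≥0) => W t ω i) P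

/-- The complement in `ℝᵈ` of the union of the closed balls with centres `c n`
and radii `r n`. -/
def complementRegion {d : ℕ} (c : ℕ → EuclideanSpace ℝ (Fin d)) (r : ℕ → ℝ) :
    Set (EuclideanSpace ℝ (Fin d)) :=
  (⋃ n, Metric.closedBall (c n) (r n))ᶜ

/-- A configuration of balls: a sequence of pairwise disjoint (non-degenerate) closed balls
whose complement is a region (open and connected) that contains the origin. -/
structure IsBallConfiguration {d : ℕ} (c : ℕ → EuclideanSpace ℝ (Fin d)) (r : ℕ → ℝ) :
    Prop where
  radius_pos : ∀ n, 0 < r n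
  disjoint : ∀ n m, n ≠ m →
    Disjoint (Metric.closedBall (c n) (r n)) (Metric.closedBall (c m) (r m))
  isOpen_region : IsOpen (complementRegion c r)
  isConnected_region : IsConnected (complementRegion c r)
  zero_mem_region : (0 : EuclideanSpace ℝ (Fin d)) ∈ complementRegion c r

/-- The separation condition on the centres of the balls. -/
def Separated {d : ℕ} (c : ℕ → EuclideanSpace ℝ (Fin d)) : Prop :=
  ∃ ε : ℝ, 0 < ε ∧ ∀ n m, n ≠ m → 2 * ε ≤ dist (c n) (c m)

/-- The balls are avoidable: Brownian motion in `ℝᵈ` started at `0` has a positive probability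
of never hitting any of them. This probability depends only on the law of Brownian motion, so
it is required for every process that is a Brownian motion. -/
def Avoidable {d : ℕ} (c : ℕ → EuclideanSpace ℝ (Fin d)) (r : ℕ → ℝ) : Prop :=
  ∀ (Ω : Type u) [MeasurableSpace Ω] (P : Measure Ω)
    (W : ℝ≥0 → Ω → EuclideanSpace ℝ (Fin d)), IsBrownianMotion W P →
      0 < P {ω | ∀ t : ℝ≥0, ∀ n : ℕ, W t ω ∉ Metric.closedBall (c n) (r n)}

/-- The centres of a string of `2 * k` balls: the points `(m + i, 0, 0)`, `1 ≤ i ≤ 2 * k`,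
of the first coordinate axis of `ℝ³`. -/
def stringCentres (m k : ℕ) : Set (EuclideanSpace ℝ (Fin 3)) :=
  {x | ∃ i : ℕ, 1 ≤ i ∧ i ≤ 2 * k ∧ x = EuclideanSpace.single 0 ((m : ℝ) + (i : ℝ))}

/-!
A nonnegative function that is excessive for Brownian motion is a supermartingale along its paths,
so the maximal inequality bounds the probability that it ever exceeds `1` by its value at the
starting point. The Newtonian kernel `1 / |x|` on `ℝ³` is excessive, because up to a constant it is
the Green function `∫ p_t(x) dt`, and the Gaussian semigroup shifts the heat kernel `p_t` in time.
Hence sums of Newtonian potentials of charges are excessive too. Unit charges at the centres of a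
string of `2k` balls with offset `m` produce a potential at most `2k / m` at the origin, but at
least the harmonic number of `k`, hence about `log k`, on each of its balls. With `m = k` the
strings have bounded potentials at the origin, while weights of order `1 / log k`, summable when `k`
grows doubly exponentially, make the total potential exceed `1` on all the balls and stay below
`1` at the origin. Each such string nevertheless contributes a constant to `∑ r / |c|`.
-/

open scoped ENNReal

section RandomWalk

theorem measurable_partialSum {X : Type*} [AddMonoid X] [MeasurableSpace X] [MeasurableAdd₂ X]
    {N : ℕ} (j : Fin (N + 1)) : Measurable fun y : Fin N → X ↦ Fin.partialSum y j := by
  induction j using Fin.induction with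
  | zero => simp only [Fin.partialSum_zero, measurable_const]
  | succ j ih =>
    simp only [Fin.partialSum_succ]
    exact ih.add (measurable_pi_apply j)

theorem mul_pi_exists_le_partialSum_le {X : Type*} [AddMonoid X] [MeasurableSpace X]
    [MeasurableAdd₂ X] {f : X → ℝ≥0∞} (hf : Measurable f) (a : ℝ≥0∞) {N : ℕ}
    (μ : Fin N → Measure X) [∀ j, IsProbabilityMeasure (μ j)]
    (hexc : ∀ j x, ∫⁻ y, f (x + y) ∂μ j ≤ f x) (x : X) :
    a * Measure.pi μ {y | ∃ j, a ≤ f (x + Fin.partialSum y j)} ≤ f x := by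
  by_cases hx : a ≤ f x
  · exact (mul_le_of_le_one_right' prob_le_one).trans hx
  induction N generalizing x with
  | zero => simp [Fin.partialSum_zero, hx, Subsingleton.elim _ (0 : Fin 1)]
  | succ N ih =>
    replace ih : ∀ x, a * Measure.pi (fun j : Fin N ↦ μ j.succ)
        {y | ∃ j, a ≤ f (x + Fin.partialSum y j)} ≤ f x := fun x ↦ by
      by_cases hx : a ≤ f x
      · exact (mul_le_of_le_one_right' prob_le_one).trans hx
      · exact ih _ (fun j ↦ hexc j.succ) x hx
    let hit : Set (X × (Fin N → X)) := {p | ∃ j, a ≤ f (x + p.1 + Fin.partialSum p.2 j)}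
    have hit_meas : MeasurableSet hit := by
      simp only [hit, Set.ofPred_exists]
      exact .iUnion fun j ↦ measurableSet_le measurable_const <| hf.comp <|
        (measurable_fst.const_add x).add ((measurable_partialSum j).comp measurable_snd)
    have first_step : {y : Fin (N + 1) → X | ∃ j, a ≤ f (x + Fin.partialSum y j)} =
        MeasurableEquiv.piFinSuccAbove (fun _ ↦ X) 0 ⁻¹' hit := by
      ext y
      simp [Fin.exists_fin_succ, Fin.partialSum_succ', hx, hit, add_assoc, Fin.tail_def,
        MeasurableEquiv.piFinSuccAbove]
    rw [first_step, (measurePreserving_piFinSuccAbove μ 0).measure_preimage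
      hit_meas.nullMeasurableSet, Measure.prod_apply hit_meas,
      ← lintegral_const_mul _ (measurable_measure_prodMk_left hit_meas)]
    exact (lintegral_mono fun y ↦ ih (x + y)).trans (hexc 0 x)

end RandomWalk

section Independence

theorem pi_pi_map_swap {ι κ X : Type*} [Fintype ι] [Fintype κ] [MeasurableSpace X]
    (μ : ι → κ → Measure X) [∀ i j, IsProbabilityMeasure (μ i j)] :
    (Measure.pi fun i ↦ Measure.pi (μ i)).map Function.swap =
      Measure.pi fun j ↦ Measure.pi fun i ↦ μ i j := by
  have swap_law : (Measure.infinitePi fun p : ι × κ ↦ μ p.1 p.2).map (fun x p ↦ x p.swap) =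
      Measure.infinitePi fun p : κ × ι ↦ μ p.2 p.1 :=
    Measure.map_infinitePi_infinitePi_of_inj Prod.swap_injective
  simp_rw [← Measure.infinitePi_eq_pi]
  rw [← Measure.infinitePi_map_curry μ, ← Measure.infinitePi_map_curry fun j i ↦ μ i j, ← swap_law,
    Measure.map_map (by fun_prop) (by fun_prop), Measure.map_map (by fun_prop) (by fun_prop)]
  rfl

theorem iIndepFun_swap {Ω ι κ X : Type*} [MeasurableSpace Ω] {P : Measure Ω} [Finite ι] [Finite κ]
    [MeasurableSpace X] {Y : ι → κ → Ω → X} (hY : ∀ i j, AEMeasurable (Y i j) P)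
    (hrows : iIndepFun (fun i ω j ↦ Y i j ω) P) (hentries : ∀ i, iIndepFun (Y i) P) :
    iIndepFun (fun j ω i ↦ Y i j ω) P := by
  have := Fintype.ofFinite ι
  have := Fintype.ofFinite κ
  have := hrows.isProbabilityMeasure
  have hprob i j : IsProbabilityMeasure (P.map (Y i j)) := Measure.isProbabilityMeasure_map (hY i j)
  have row_law i : HasLaw (fun ω j ↦ Y i j ω) (Measure.pi fun j ↦ P.map (Y i j)) P :=
    (hentries i).hasLaw_pi fun j ↦ ⟨hY i j, rfl⟩
  have column_law j : HasLaw (fun ω i ↦ Y i j ω) (Measure.pi fun i ↦ P.map (Y i j)) P :=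
    (hrows.comp (fun _ x ↦ x j) fun _ ↦ measurable_pi_apply j).hasLaw_pi fun i ↦ ⟨hY i j, rfl⟩
  have measurable_swap : Measurable (Function.swap : (ι → κ → X) → κ → ι → X) :=
    measurable_pi_lambda _ fun j ↦ measurable_pi_lambda _ fun i ↦
      (measurable_pi_apply j).comp (measurable_pi_apply i)
  rw [iIndepFun_iff_hasLaw_pi_pi column_law]
  exact HasLaw.comp ⟨measurable_swap.aemeasurable, pi_pi_map_swap fun i j ↦ P.map (Y i j)⟩
    (hrows.hasLaw_pi row_law)

end Independence

section BrownianMotion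

variable {ι : Type*} [Fintype ι]

/-- The law on `ℝ^ι` of independent centred real Gaussians of variance `v`: the law of the
increments of Brownian motion over time intervals of length `v`. -/
noncomputable def isotropicGaussian (v : ℝ≥0) : Measure (EuclideanSpace ℝ ι) :=
  (Measure.pi fun _ ↦ gaussianReal 0 v).map (WithLp.toLp 2)

instance isProbabilityMeasure_isotropicGaussian (v : ℝ≥0) :
    IsProbabilityMeasure (isotropicGaussian v : Measure (EuclideanSpace ℝ ι)) :=
  Measure.isProbabilityMeasure_map (by fun_prop)

/-- Excessive functions of Brownian motion, through their defining inequality `P_v f ≤ f` for the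
Gaussian transition semigroup; for lower semicontinuous `f` the convergence `P_v f → f` as `v → 0`
follows. -/
def GaussianExcessive (f : EuclideanSpace ℝ ι → ℝ≥0∞) : Prop :=
  ∀ v x, ∫⁻ y, f (x + y) ∂isotropicGaussian v ≤ f x

theorem GaussianExcessive.comp_sub_right {f : EuclideanSpace ℝ ι → ℝ≥0∞}
    (hf : GaussianExcessive f) (c : EuclideanSpace ℝ ι) :
    GaussianExcessive fun x ↦ f (x - c) := fun v x ↦ by
  simpa only [sub_add_eq_add_sub] using hf v (x - c)

theorem GaussianExcessive.const_mul {f : EuclideanSpace ℝ ι → ℝ≥0∞} (hf : GaussianExcessive f)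
    {a : ℝ≥0∞} (ha : a ≠ ⊤) : GaussianExcessive fun x ↦ a * f x := fun v x ↦ by
  rw [lintegral_const_mul' a _ ha]
  exact mul_le_mul_right (hf v x) a

theorem GaussianExcessive.sum {κ : Type*} {s : Finset κ} {f : κ → EuclideanSpace ℝ ι → ℝ≥0∞}
    (hf : ∀ j ∈ s, GaussianExcessive (f j)) (hfm : ∀ j ∈ s, Measurable (f j)) :
    GaussianExcessive fun x ↦ ∑ j ∈ s, f j x := fun v x ↦ by
  refine (lintegral_finsetSum' s fun j hj ↦
    ((hfm j hj).comp (measurable_const_add x)).aemeasurable).trans_le ?_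
  exact Finset.sum_le_sum fun j hj ↦ hf j hj v x

theorem GaussianExcessive.tsum {κ : Type*} [Countable κ] {f : κ → EuclideanSpace ℝ ι → ℝ≥0∞}
    (hf : ∀ j, GaussianExcessive (f j)) (hfm : ∀ j, Measurable (f j)) :
    GaussianExcessive fun x ↦ ∑' j, f j x := fun v x ↦ by
  refine (lintegral_tsum fun j ↦
    ((hfm j).comp (measurable_const_add x)).aemeasurable).trans_le ?_
  exact ENNReal.tsum_le_tsum fun j ↦ hf j v x

variable {d : ℕ} {Ω : Type*} [MeasurableSpace Ω] {P : Measure Ω}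
  {W : ℝ≥0 → Ω → EuclideanSpace ℝ (Fin d)}

theorem IsBrownianMotion.isProbabilityMeasure (hW : IsBrownianMotion W P) :
    IsProbabilityMeasure P :=
  hW.indep.isProbabilityMeasure

theorem IsBrownianMotion.ae_zero_eq_zero (hW : IsBrownianMotion W P) : ∀ᵐ ω ∂P, W 0 ω = 0 := by
  filter_upwards [ae_all_iff.2 fun i ↦ (hW.coord i).eval_zero_ae_eq_zero] with ω hω
  ext i
  exact hω i

theorem IsBrownianMotion.ae_continuous (hW : IsBrownianMotion W P) :
    ∀ᵐ ω ∂P, Continuous fun t ↦ W t ω := by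
  filter_upwards [ae_all_iff.2 fun i ↦ (hW.coord i).cont] with ω hω
  exact (PiLp.continuous_toLp 2 _).comp (continuous_pi hω)

theorem IsBrownianMotion.hasLaw_sub (hW : IsBrownianMotion W P) (s t : ℝ≥0) :
    HasLaw (fun ω ↦ W s ω - W t ω) (isotropicGaussian (nndist s t)) P := by
  have coordinates_indep : iIndepFun (fun i ω ↦ W s ω i - W t ω i) P :=
    hW.indep.comp (fun _ w ↦ w s - w t) fun _ ↦ by fun_prop
  have coordinates_law := coordinates_indep.hasLaw_pi fun i ↦ (hW.coord i).hasLaw_sub s t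
  exact HasLaw.comp ⟨by fun_prop, rfl⟩ coordinates_law

theorem IsBrownianMotion.hasIndepIncrements (hW : IsBrownianMotion W P) :
    HasIndepIncrements W P := fun n t ht ↦ by
  have coordinates_indep : iIndepFun
      (fun i ω (j : Fin n) ↦ W (t j.succ) ω i - W (t j.castSucc) ω i) P :=
    hW.indep.comp (fun _ w (j : Fin n) ↦ w (t j.succ) - w (t j.castSucc)) fun _ ↦ by fun_prop
  have increments_indep := iIndepFun_swap
    (fun i (j : Fin n) ↦ ((hW.coord i).hasLaw_sub (t j.succ) (t j.castSucc)).aemeasurable)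
    coordinates_indep fun i ↦ (hW.coord i).hasIndepIncrements n t ht
  exact increments_indep.comp (fun _ ↦ WithLp.toLp 2) fun _ ↦ by fun_prop

theorem IsBrownianMotion.mul_measure_exists_monotone_le (hW : IsBrownianMotion W P)
    {f : EuclideanSpace ℝ (Fin d) → ℝ≥0∞} (hf : Measurable f) (hexc : GaussianExcessive f)
    (a : ℝ≥0∞) {n : ℕ} {t : Fin (n + 1) → ℝ≥0} (ht : Monotone t) (ht0 : t 0 = 0) :
    a * P {ω | ∃ j, a ≤ f (W (t j) ω)} ≤ f 0 := by
  have increments_law := iIndepFun.hasLaw_pi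
    (fun j : Fin n ↦ hW.hasLaw_sub (t j.succ) (t j.castSucc)) (hW.hasIndepIncrements n t ht)
  have random_walk := mul_pi_exists_le_partialSum_le hf a
    (fun j : Fin n ↦ isotropicGaussian (nndist (t j.succ) (t j.castSucc))) (fun _ ↦ hexc _) 0
  rw [← increments_law.map_eq] at random_walk
  refine le_trans (mul_le_mul_right (le_trans (measure_mono_ae ?_)
    (Measure.le_map_apply increments_law.aemeasurable _)) a) random_walk
  filter_upwards [hW.ae_zero_eq_zero] with ω h0
  rintro ⟨j, hj⟩
  refine ⟨j, hj.trans_eq ?_⟩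
  have telescope := congrFun (Fin.partialSum_left_neg fun j ↦ W (t j) ω) j
  simp only [ht0, h0, neg_add_eq_sub, Pi.vadd_apply, vadd_eq_add] at telescope
  rw [telescope]

theorem IsBrownianMotion.mul_measure_exists_mem_finset_le (hW : IsBrownianMotion W P)
    {f : EuclideanSpace ℝ (Fin d) → ℝ≥0∞} (hf : Measurable f) (hexc : GaussianExcessive f)
    (a : ℝ≥0∞) (T : Finset ℝ≥0) :
    a * P {ω | ∃ t ∈ T, a ≤ f (W t ω)} ≤ f 0 := by
  obtain ⟨n, hn⟩ : ∃ n, (insert 0 T).card = n + 1 :=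
    Nat.exists_eq_succ_of_ne_zero (Finset.insert_nonempty 0 T).card_ne_zero
  let e := (insert 0 T).orderEmbOfFin hn
  have e_zero : e 0 = 0 := by
    refine (Finset.orderEmbOfFin_zero hn n.succ_pos).trans (le_antisymm ?_ zero_le)
    exact Finset.min'_le _ _ (Finset.mem_insert_self 0 T)
  refine le_trans (mul_le_mul_right (measure_mono ?_) a)
    (hW.mul_measure_exists_monotone_le hf hexc a e.monotone e_zero)
  rintro ω ⟨t, ht, hft⟩
  have mem_range : t ∈ Set.range e := by simp [e, Finset.range_orderEmbOfFin, ht]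
  obtain ⟨j, rfl⟩ := mem_range
  exact ⟨j, hft⟩

theorem IsBrownianMotion.mul_measure_exists_lt_le (hW : IsBrownianMotion W P)
    {f : EuclideanSpace ℝ (Fin d) → ℝ≥0∞} (hf : LowerSemicontinuous f)
    (hexc : GaussianExcessive f) (a : ℝ≥0∞) :
    a * P {ω | ∃ t, a < f (W t ω)} ≤ f 0 := by
  let q := TopologicalSpace.denseSeq ℝ≥0
  let hit (n : ℕ) : Set Ω := {ω | ∃ t ∈ (Finset.range n).image q, a ≤ f (W t ω)}
  have hit_mono : Monotone hit := by
    rintro n m hnm ω ⟨t, ht, hft⟩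
    exact ⟨t, Finset.image_subset_image (Finset.range_mono hnm) ht, hft⟩
  have hit_ae : {ω | ∃ t, a < f (W t ω)} ≤ᵐ[P] ⋃ n, hit n := by
    filter_upwards [hW.ae_continuous] with ω hω
    rintro ⟨t, ht⟩
    have times_open : IsOpen {t | a < f (W t ω)} := (hf.isOpen_preimage a).preimage hω
    obtain ⟨n, hn⟩ := (TopologicalSpace.denseRange_denseSeq ℝ≥0).exists_mem_open times_open ⟨t, ht⟩
    exact Set.mem_iUnion.2 ⟨n + 1, q n, Finset.mem_image_of_mem q (Finset.self_mem_range_succ n),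
      le_of_lt hn⟩
  refine (mul_le_mul_right (measure_mono_ae hit_ae) a).trans ?_
  rw [hit_mono.measure_iUnion, ENNReal.mul_iSup]
  exact iSup_le fun n ↦ hW.mul_measure_exists_mem_finset_le hf.measurable hexc a _

theorem avoidable_of_gaussianExcessive {c : ℕ → EuclideanSpace ℝ (Fin d)} {r : ℕ → ℝ}
    {f : EuclideanSpace ℝ (Fin d) → ℝ≥0∞} (hf : LowerSemicontinuous f)
    (hexc : GaussianExcessive f) {a : ℝ≥0∞} (hf0 : f 0 < a)
    (hfa : ∀ n, ∀ x ∈ Metric.closedBall (c n) (r n), a < f x) : Avoidable.{u} c r := by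
  intro Ω _ P W hW
  have := hW.isProbabilityMeasure
  refine pos_iff_ne_zero.2 fun avoid_null ↦ hf0.not_ge ?_
  have ae_hit : ∀ᵐ ω ∂P, ∃ t, a < f (W t ω) := by
    filter_upwards [measure_eq_zero_iff_ae_notMem.1 avoid_null] with ω hω
    simp only [not_forall, not_not] at hω
    obtain ⟨t, n, htn⟩ := hω
    exact ⟨t, hfa n _ htn⟩
  calc a = a * P {ω | ∃ t, a < f (W t ω)} := by
        rw [measure_congr (eventuallyEq_univ.2 ae_hit), measure_univ, mul_one]
    _ ≤ f 0 := hW.mul_measure_exists_lt_le hf hexc a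

end BrownianMotion

section GreenFunction

open Real

theorem measurable_gaussianPDF_uncurry :
    Measurable fun p : ℝ≥0 × ℝ ↦ gaussianPDF 0 p.1 p.2 := by
  simp only [gaussianPDF_def, gaussianPDFReal_def]
  fun_prop

theorem gaussianPDFReal_add_mul_gaussianPDFReal {t v : ℝ≥0} (ht : t ≠ 0) (hv : v ≠ 0) (x y : ℝ) :
    gaussianPDFReal 0 v y * gaussianPDFReal 0 t (x + y) =
      gaussianPDFReal 0 (t + v) x * gaussianPDFReal (-(x * v / (t + v))) (t * v / (t + v)) y := by
  have normalization : (√(2 * π * v))⁻¹ * (√(2 * π * t))⁻¹ =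
      (√(2 * π * (t + v)))⁻¹ * (√(2 * π * (t * v / (t + v))))⁻¹ := by
    rw [← mul_inv, ← mul_inv, ← sqrt_mul (by positivity), ← sqrt_mul (by positivity)]
    congr 2
    field_simp
  have exponent : -y ^ 2 / (2 * v) + -(x + y) ^ 2 / (2 * t) =
      -x ^ 2 / (2 * (t + v)) + -(y + x * v / (t + v)) ^ 2 / (2 * (t * v / (t + v))) := by
    field_simp
    ring
  simp only [gaussianPDFReal_def, sub_zero, sub_neg_eq_add, NNReal.coe_add, NNReal.coe_div,
    NNReal.coe_mul]
  rw [mul_mul_mul_comm, mul_mul_mul_comm (√(2 * π * (t + v)))⁻¹, normalization, ← exp_add,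
    ← exp_add, exponent]

theorem lintegral_gaussianPDF_add {t : ℝ≥0} (ht : t ≠ 0) (v : ℝ≥0) (x : ℝ) :
    ∫⁻ y, gaussianPDF 0 t (x + y) ∂gaussianReal 0 v = gaussianPDF 0 (t + v) x := by
  rcases eq_or_ne v 0 with rfl | hv
  · simp
  calc ∫⁻ y, gaussianPDF 0 t (x + y) ∂gaussianReal 0 v
      = ∫⁻ y, gaussianPDF 0 v y * gaussianPDF 0 t (x + y) := by
        rw [gaussianReal_of_var_ne_zero 0 hv,
          lintegral_withDensity_eq_lintegral_mul _ (by fun_prop) (by fun_prop)]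
        rfl
    _ = ∫⁻ y, gaussianPDF 0 (t + v) x *
          gaussianPDF (-(x * v / (t + v))) (t * v / (t + v)) y := by
        simp only [gaussianPDF_def, ← ENNReal.ofReal_mul (gaussianPDFReal_nonneg _ _ _),
          gaussianPDFReal_add_mul_gaussianPDFReal ht hv]
    _ = gaussianPDF 0 (t + v) x := by
        rw [lintegral_const_mul _ (by fun_prop), lintegral_gaussianPDF_eq_one _ (by positivity),
          mul_one]

theorem lintegral_rpow_mul_exp_neg_mul_Ioi {a r : ℝ} (ha : 0 < a) (hr : 0 ≤ r) :
    ∫⁻ u in Set.Ioi 0, ENNReal.ofReal (u ^ (a - 1) * exp (-(r * u))) =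
      ENNReal.ofReal (Gamma a) * (ENNReal.ofReal r)⁻¹ ^ a := by
  have integrand_nonneg :
      0 ≤ᵐ[volume.restrict (Set.Ioi 0)] fun u ↦ u ^ (a - 1) * exp (-(r * u)) := by
    filter_upwards [ae_restrict_mem measurableSet_Ioi] with u hu
    exact mul_nonneg (rpow_nonneg (le_of_lt hu) _) (exp_pos _).le
  rcases hr.eq_or_lt with rfl | hr
  · have not_integrable := not_integrableOn_Ioi_rpow (a - 1)
    simp only [zero_mul, neg_zero, exp_zero, mul_one] at integrand_nonneg ⊢
    rw [ENNReal.ofReal_zero, ENNReal.inv_zero, ENNReal.top_rpow_of_pos ha,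
      ENNReal.mul_top (ENNReal.ofReal_pos.2 (Gamma_pos_of_pos ha)).ne']
    contrapose! not_integrable
    exact ⟨by fun_prop, (hasFiniteIntegral_iff_ofReal integrand_nonneg).2 not_integrable.lt_top⟩
  · have gamma_integral := integral_rpow_mul_exp_neg_mul_Ioi ha hr
    have gamma_pos := Gamma_pos_of_pos ha
    rw [← ofReal_integral_eq_lintegral_ofReal (.of_integral_ne_zero (by
        rw [gamma_integral]; positivity)) integrand_nonneg, gamma_integral, mul_comm, one_div,
      ENNReal.ofReal_mul gamma_pos.le, ← ENNReal.ofReal_rpow_of_pos (inv_pos.2 hr),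
      ENNReal.ofReal_inv_of_pos hr]

theorem lintegral_Ioi_eq_lintegral_Ioi_comp_inv (f : ℝ → ℝ≥0∞) :
    ∫⁻ t in Set.Ioi 0, f t = ∫⁻ u in Set.Ioi 0, ENNReal.ofReal ((u ^ 2)⁻¹) * f u⁻¹ := by
  have image_inv : (fun u : ℝ ↦ u⁻¹) '' Set.Ioi 0 = Set.Ioi 0 := by
    rw [Set.image_inv_eq_inv]
    ext u
    simp
  conv_lhs => rw [← image_inv]
  rw [lintegral_image_eq_lintegral_abs_deriv_mul measurableSet_Ioi
    (fun u hu ↦ (hasDerivAt_inv (ne_of_gt hu)).hasDerivWithinAt) inv_injective.injOn]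
  simp

variable {ι : Type*} [Fintype ι]

/-- The Gaussian transition density of Brownian motion in `ℝ^ι` at time `t`. -/
noncomputable def heatKernel (t : ℝ≥0) (x : EuclideanSpace ℝ ι) : ℝ≥0∞ :=
  ∏ i, gaussianPDF 0 t (x i)

theorem measurable_heatKernel_uncurry :
    Measurable fun p : ℝ≥0 × EuclideanSpace ℝ ι ↦ heatKernel p.1 p.2 :=
  Finset.measurable_fun_prod _ fun i _ ↦ measurable_gaussianPDF_uncurry.comp
    (f := fun p : ℝ≥0 × EuclideanSpace ℝ ι ↦ (p.1, p.2 i)) (by fun_prop)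

theorem lintegral_heatKernel_add {t : ℝ≥0} (ht : t ≠ 0) (v : ℝ≥0) (x : EuclideanSpace ℝ ι) :
    ∫⁻ y, heatKernel t (x + y) ∂isotropicGaussian v = heatKernel (t + v) x := by
  have factors_indep : iIndepFun (fun i (y : ι → ℝ) ↦ gaussianPDF 0 t (x i + y i))
      (Measure.pi fun _ ↦ gaussianReal 0 v) :=
    iIndepFun_pi (X := fun i y ↦ gaussianPDF 0 t (x i + y)) fun i ↦ by fun_prop
  calc ∫⁻ y, heatKernel t (x + y) ∂isotropicGaussian v
      = ∫⁻ y : ι → ℝ, ∏ i, gaussianPDF 0 t (x i + y i) ∂Measure.pi fun _ ↦ gaussianReal 0 v :=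
        lintegral_map
          (measurable_heatKernel_uncurry.comp (f := fun y ↦ (t, x + y)) (by fun_prop))
          (by fun_prop)
    _ = ∏ i, ∫⁻ y : ι → ℝ, gaussianPDF 0 t (x i + y i) ∂Measure.pi fun _ ↦ gaussianReal 0 v :=
        lintegral_prod_eq_prod_lintegral_of_indepFun _ _ factors_indep fun i ↦ by fun_prop
    _ = ∏ i, ∫⁻ y, gaussianPDF 0 t (x i + y) ∂gaussianReal 0 v :=
        Finset.prod_congr rfl fun i _ ↦
          (measurePreserving_eval (fun _ ↦ gaussianReal 0 v) i).lintegral_comp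
            (f := fun y ↦ gaussianPDF 0 t (x i + y)) (by fun_prop)
    _ = heatKernel (t + v) x := by simp only [lintegral_gaussianPDF_add ht, heatKernel]

theorem heatKernel_eq (t : ℝ≥0) (x : EuclideanSpace ℝ ι) :
    heatKernel t x = ENNReal.ofReal
      ((√(2 * π * t))⁻¹ ^ Fintype.card ι * exp (-‖x‖ ^ 2 / (2 * t))) := by
  simp only [heatKernel, gaussianPDF_def]
  rw [← ENNReal.ofReal_prod_of_nonneg fun i _ ↦ gaussianPDFReal_nonneg _ _ _]
  simp only [gaussianPDFReal_def, sub_zero, Finset.prod_mul_distrib, Finset.prod_const,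
    Finset.card_univ, ← exp_sum, ← Finset.sum_div, Finset.sum_neg_distrib,
    EuclideanSpace.real_norm_sq_eq]

/-- The Green function of Brownian motion in `ℝ^ι` with pole at the origin: the density of the
expected occupation time. -/
noncomputable def greenFunction (x : EuclideanSpace ℝ ι) : ℝ≥0∞ :=
  ∫⁻ t in Set.Ioi (0 : ℝ), heatKernel t.toNNReal x

theorem gaussianExcessive_greenFunction :
    GaussianExcessive (greenFunction : EuclideanSpace ℝ ι → ℝ≥0∞) := fun v x ↦ by
  have heatKernel_measurable : Measurable fun p : EuclideanSpace ℝ ι × ℝ ↦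
      heatKernel p.2.toNNReal (x + p.1) :=
    measurable_heatKernel_uncurry.comp
      (f := fun p : EuclideanSpace ℝ ι × ℝ ↦ (p.2.toNNReal, x + p.1)) (by fun_prop)
  calc ∫⁻ y, greenFunction (x + y) ∂isotropicGaussian v
      = ∫⁻ t in Set.Ioi (0 : ℝ), ∫⁻ y, heatKernel t.toNNReal (x + y) ∂isotropicGaussian v :=
        lintegral_lintegral_swap heatKernel_measurable.aemeasurable
    _ = ∫⁻ t in Set.Ioi (0 : ℝ), heatKernel (t + v).toNNReal x := by
        refine setLIntegral_congr_fun measurableSet_Ioi fun t ht ↦ ?_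
        rw [lintegral_heatKernel_add (toNNReal_pos.2 ht).ne',
          toNNReal_add (le_of_lt ht) v.coe_nonneg, toNNReal_coe]
    _ = ∫⁻ t in Set.Ioi (v : ℝ), heatKernel t.toNNReal x := by
        have shift := (measurePreserving_add_right volume (v : ℝ)).setLIntegral_comp_preimage
          (measurableSet_Ioi (a := (v : ℝ))) (measurable_heatKernel_uncurry.comp
            (f := fun t : ℝ ↦ (t.toNNReal, x)) (by fun_prop))
        rwa [Set.preimage_add_const_Ioi, sub_self] at shift
    _ ≤ greenFunction x := lintegral_mono_set (Set.Ioi_subset_Ioi v.2)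

theorem greenFunction_eq (hι : 2 < Fintype.card ι) (x : EuclideanSpace ℝ ι) :
    greenFunction x = ENNReal.ofReal ((√(2 * π))⁻¹ ^ Fintype.card ι *
      Gamma (Fintype.card ι / 2 - 1)) * (ENNReal.ofReal (‖x‖ ^ 2 / 2))⁻¹ ^
        (Fintype.card ι / 2 - 1 : ℝ) := by
  have hι' : (0 : ℝ) < Fintype.card ι / 2 - 1 := by
    have : (2 : ℝ) < Fintype.card ι := by exact_mod_cast hι
    linarith
  rw [ENNReal.ofReal_mul (by positivity), mul_assoc,
    ← lintegral_rpow_mul_exp_neg_mul_Ioi hι' (by positivity), greenFunction,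
    lintegral_Ioi_eq_lintegral_Ioi_comp_inv, ← lintegral_const_mul _ (by fun_prop)]
  refine setLIntegral_congr_fun measurableSet_Ioi fun u (hu : 0 < u) ↦ ?_
  have power_of_time :
      (u ^ 2)⁻¹ * (√u) ^ Fintype.card ι = u ^ (Fintype.card ι / 2 - 1 - 1 : ℝ) := by
    rw [sqrt_eq_rpow, ← rpow_natCast _ (Fintype.card ι), ← rpow_mul hu.le, ← rpow_natCast u 2,
      ← rpow_neg hu.le, ← rpow_add hu]
    congr 1
    push_cast
    ring
  rw [heatKernel_eq, ← ENNReal.ofReal_mul (by positivity), ← ENNReal.ofReal_mul (by positivity),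
    ← power_of_time, coe_toNNReal _ (inv_nonneg.2 hu.le), sqrt_mul (by positivity), sqrt_inv,
    mul_inv, inv_inv, mul_pow]
  congr 1
  have exponent : -‖x‖ ^ 2 / (2 * u⁻¹) = -(‖x‖ ^ 2 / 2 * u) := by field_simp
  rw [exponent]
  ring

theorem exists_greenFunction_eq_mul (hι : 2 < Fintype.card ι) :
    ∃ C : ℝ≥0∞, C ≠ 0 ∧ C ≠ ⊤ ∧
      ∀ x : EuclideanSpace ℝ ι, greenFunction x = C * (‖x‖ₑ ^ (Fintype.card ι - 2))⁻¹ := by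
  have hι' : (0 : ℝ) < Fintype.card ι / 2 - 1 := by
    have : (2 : ℝ) < Fintype.card ι := by exact_mod_cast hι
    linarith
  have constant_pos : 0 < (√(2 * π))⁻¹ ^ Fintype.card ι * Gamma (Fintype.card ι / 2 - 1) :=
    mul_pos (by positivity) (Gamma_pos_of_pos hι')
  refine ⟨ENNReal.ofReal ((√(2 * π))⁻¹ ^ Fintype.card ι * Gamma (Fintype.card ι / 2 - 1)) *
    2 ^ (Fintype.card ι / 2 - 1 : ℝ), ?_, by finiteness, fun x ↦ ?_⟩
  · exact mul_ne_zero (ENNReal.ofReal_pos.2 constant_pos).ne' (by simp)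
  have enorm_sq : ENNReal.ofReal (‖x‖ ^ 2 / 2) = ‖x‖ₑ ^ 2 / 2 := by
    rw [ENNReal.ofReal_div_of_pos two_pos, ENNReal.ofReal_pow (norm_nonneg x), ofReal_norm,
      ENNReal.ofReal_ofNat]
  have exponent : (2 : ℕ) * (Fintype.card ι / 2 - 1 : ℝ) = (Fintype.card ι - 2 : ℕ) := by
    push_cast [hι.le]
    ring
  rw [greenFunction_eq hι, mul_assoc, enorm_sq, ENNReal.inv_div (by simp) (by simp),
    div_eq_mul_inv (2 : ℝ≥0∞), ENNReal.mul_rpow_of_nonneg _ _ hι'.le, ENNReal.inv_rpow,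
    ← ENNReal.rpow_natCast_mul, exponent, ENNReal.rpow_natCast]

theorem gaussianExcessive_inv_enorm_pow (hι : 2 < Fintype.card ι) :
    GaussianExcessive fun x : EuclideanSpace ℝ ι ↦ (‖x‖ₑ ^ (Fintype.card ι - 2))⁻¹ := by
  obtain ⟨C, C_ne_zero, C_ne_top, green_eq⟩ := exists_greenFunction_eq_mul hι
  have := (gaussianExcessive_greenFunction (ι := ι)).const_mul (ENNReal.inv_ne_top.2 C_ne_zero)
  simpa only [green_eq, ENNReal.inv_mul_cancel_left C_ne_zero C_ne_top] using this

theorem gaussianExcessive_inv_enorm :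
    GaussianExcessive fun x : EuclideanSpace ℝ (Fin 3) ↦ ‖x‖ₑ⁻¹ := by
  simpa using gaussianExcessive_inv_enorm_pow (ι := Fin 3) (by simp)

end GreenFunction

section Region

section InnerProductSpace

open Metric

variable {E : Type*} [NormedAddCommGroup E] [InnerProductSpace ℝ E] {V : Submodule ℝ E}

theorem dist_le_dist_add_of_mem_orthogonal {v x u : E} (hv : v ∈ V) (hu : u ∈ Vᗮ)
    (hxu : 0 ≤ inner ℝ x u) : dist x v ≤ dist (x + u) v := by
  have inner_sub : inner ℝ (x - v) u = inner ℝ x u := by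
    rw [inner_sub_left, (Submodule.mem_orthogonal V u).1 hu v hv, sub_zero]
  rw [dist_eq_norm, dist_eq_norm, add_sub_right_comm, ← sq_le_sq₀ (norm_nonneg _) (norm_nonneg _),
    norm_add_sq_real, inner_sub]
  nlinarith [sq_nonneg ‖u‖]

variable [V.HasOrthogonalProjection]

theorem norm_starProjection_orthogonal_le_dist {v : E} (hv : v ∈ V) (x : E) :
    ‖Vᗮ.starProjection x‖ ≤ dist x v := by
  have proj_v : Vᗮ.starProjection v = 0 :=
    Submodule.eq_starProjection_of_mem_orthogonal' (zero_mem _) (V.le_orthogonal_orthogonal hv)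
      (zero_add v).symm
  rw [← sub_zero (Vᗮ.starProjection x), ← proj_v, ← map_sub, dist_eq_norm]
  exact Vᗮ.norm_starProjection_apply_le _

theorem norm_le_norm_starProjection_orthogonal_add {x u : E} (hu : u ∈ Vᗮ)
    (hxu : 0 ≤ inner ℝ x u) : ‖u‖ ≤ ‖Vᗮ.starProjection (x + u)‖ := by
  have proj_u : Vᗮ.starProjection u = u := Submodule.starProjection_eq_self_iff.2 hu
  have inner_proj : inner ℝ (Vᗮ.starProjection x) u = inner ℝ x u := by
    rw [Submodule.inner_starProjection_left_eq_right, proj_u]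
  rw [map_add, proj_u, ← sq_le_sq₀ (norm_nonneg _) (norm_nonneg _), norm_add_sq_real, inner_proj]
  nlinarith [sq_nonneg ‖Vᗮ.starProjection x‖]

theorem isConnected_setOf_lt_norm_starProjection_orthogonal (hV : 1 < Module.rank ℝ Vᗮ) {R : ℝ}
    (hR : 0 ≤ R) : IsConnected {x | R < ‖Vᗮ.starProjection x‖} := by
  let polar (p : V × Vᗮ × ℝ) : E := p.1 + p.2.2 • (p.2.1 : E)
  have image_polar : polar '' (Set.univ ×ˢ sphere 0 1 ×ˢ Set.Ioi R) =
      {x | R < ‖Vᗮ.starProjection x‖} := by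
    ext x
    constructor
    · rintro ⟨⟨v, u, s⟩, ⟨-, hu, hs : R < s⟩, rfl⟩
      have norm_u : ‖(u : E)‖ = 1 := by simpa using hu
      have proj_polar : Vᗮ.starProjection (polar (v, u, s)) = s • (u : E) :=
        Submodule.eq_starProjection_of_mem_orthogonal' (Vᗮ.smul_mem s u.2)
          (V.le_orthogonal_orthogonal v.2) (add_comm _ _)
      rwa [Set.mem_ofPred_eq, proj_polar, norm_smul, norm_u, mul_one, Real.norm_eq_abs,
        abs_of_pos (hR.trans_lt hs)]
    · intro hx
      have hx0 : ‖Vᗮ.starProjection x‖ ≠ 0 := (hR.trans_lt hx).ne'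
      refine ⟨(V.orthogonalProjectionOnto x,
        ‖Vᗮ.starProjection x‖⁻¹ • Vᗮ.orthogonalProjectionOnto x, ‖Vᗮ.starProjection x‖),
        ⟨trivial, ?_, hx⟩, ?_⟩
      · rw [mem_sphere_zero_iff_norm, norm_smul, norm_inv, norm_norm]
        exact inv_mul_cancel₀ hx0
      · simp only [polar, Submodule.coe_smul, smul_inv_smul₀ hx0]
        exact V.starProjection_add_starProjection_orthogonal x
  rw [← image_polar]
  exact ((isConnected_univ.prod ((isConnected_sphere hV 0 zero_le_one).prod isConnected_Ioi)).image
    polar (by fun_prop))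

theorem isConnected_compl_iUnion_closedBall (hV : 1 < Module.rank ℝ Vᗮ) {ι : Type*} {c : ι → E}
    (hc : ∀ i, c i ∈ V) {r : ι → ℝ} (hr : BddAbove (Set.range r)) :
    IsConnected (⋃ i, closedBall (c i) (r i))ᶜ := by
  obtain ⟨R, hR, hrR⟩ : ∃ R ≥ 0, ∀ i, r i ≤ R := by
    obtain ⟨R, hrR⟩ := hr
    exact ⟨max R 0, le_max_right _ _, fun i ↦ le_max_of_le_left (hrR ⟨i, rfl⟩)⟩
  have mem_iff (x : E) : x ∈ (⋃ i, closedBall (c i) (r i))ᶜ ↔ ∀ i, r i < dist x (c i) := by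
    simp
  have far_connected := isConnected_setOf_lt_norm_starProjection_orthogonal hV hR
  have far_subset : {x | R < ‖Vᗮ.starProjection x‖} ⊆ (⋃ i, closedBall (c i) (r i))ᶜ :=
    fun x hx ↦ (mem_iff x).2 fun i ↦
      (hrR i).trans_lt (hx.trans_le (norm_starProjection_orthogonal_le_dist (hc i) x))
  obtain ⟨p, hp⟩ := far_connected.nonempty
  refine ⟨⟨p, far_subset hp⟩, isPreconnected_of_forall p fun x hx ↦ ?_⟩
  -- Moving orthogonally to `V`, and away from it, increases the distance to every centre.
  obtain ⟨u, hu, hxu, hfar⟩ : ∃ u ∈ Vᗮ, 0 ≤ inner ℝ x u ∧ R < ‖u‖ := by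
    have hu := Vᗮ.starProjection_apply_mem p
    rcases le_total 0 (inner ℝ x (Vᗮ.starProjection p)) with hxp | hxp
    · exact ⟨_, hu, hxp, hp⟩
    · exact ⟨-Vᗮ.starProjection p, neg_mem hu, by simpa only [inner_neg_right, neg_nonneg],
        by simpa only [norm_neg]⟩
  have segment_subset : segment ℝ x (x + u) ⊆ (⋃ i, closedBall (c i) (r i))ᶜ := by
    rw [segment_eq_image']
    rintro _ ⟨t, ht, rfl⟩
    rw [add_sub_cancel_left]
    refine (mem_iff _).2 fun i ↦ ((mem_iff x).1 hx i).trans_le <|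
      dist_le_dist_add_of_mem_orthogonal (hc i) (Vᗮ.smul_mem t hu) ?_
    rw [real_inner_smul_right]
    exact mul_nonneg ht.1 hxu
  exact ⟨segment ℝ x (x + u) ∪ {x | R < ‖Vᗮ.starProjection x‖},
    Set.union_subset segment_subset far_subset, .inr hp, .inl (left_mem_segment ℝ _ _),
    (convex_segment x (x + u)).isPreconnected.union (x + u) (right_mem_segment ℝ _ _)
      (hfar.trans_le (norm_le_norm_starProjection_orthogonal_add hu hxu))
      far_connected.isPreconnected⟩

end InnerProductSpace

theorem Separated.isOpen_complementRegion {d : ℕ} {c : ℕ → EuclideanSpace ℝ (Fin d)}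
    (hc : Separated c) {ρ : ℝ} (hρ : 0 ≤ ρ) : IsOpen (complementRegion c fun _ ↦ ρ) := by
  obtain ⟨ε, hε, hsep⟩ := hc
  have range_closed : IsClosed (Set.range c) := by
    refine Metric.isClosed_of_pairwise_le_dist (ε := 2 * ε) (by positivity) ?_
    rintro _ ⟨n, rfl⟩ _ ⟨m, rfl⟩ hnm
    exact hsep n m fun h ↦ hnm (congrArg c h)
  have union_eq : ⋃ n, Metric.closedBall (c n) ρ = Metric.cthickening ρ (Set.range c) := by
    rw [range_closed.cthickening_eq_biUnion_closedBall hρ, Set.biUnion_range]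
  rw [complementRegion, union_eq]
  exact Metric.isClosed_cthickening.isOpen_compl

end Region

section AxisConfiguration

/-- The point `(s, 0, 0)`. -/
noncomputable def axisPoint (s : ℝ) : EuclideanSpace ℝ (Fin 3) :=
  EuclideanSpace.single 0 s

theorem dist_axisPoint (s t : ℝ) : dist (axisPoint s) (axisPoint t) = |s - t| := by
  rw [axisPoint, axisPoint, PiLp.dist_single_same, Real.dist_eq]

theorem norm_axisPoint (s : ℝ) : ‖axisPoint s‖ = |s| := by
  rw [axisPoint, PiLp.norm_single, Real.norm_eq_abs]

theorem one_lt_rank_orthogonal_span_axisPoint :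
    1 < Module.rank ℝ (Submodule.span ℝ {axisPoint 1})ᗮ := by
  have : Fact (Module.finrank ℝ (EuclideanSpace ℝ (Fin 3)) = 2 + 1) := ⟨by simp⟩
  have axis_ne_zero : axisPoint 1 ≠ 0 := by simp [axisPoint]
  rw [← Module.finrank_eq_rank, Submodule.finrank_orthogonal_span_singleton (n := 2) axis_ne_zero]
  norm_num

theorem isConnected_complementRegion_axisPoint (s : ℕ → ℝ) {r : ℕ → ℝ}
    (hr : BddAbove (Set.range r)) :
    IsConnected (complementRegion (fun n ↦ axisPoint (s n)) r) := by
  refine isConnected_compl_iUnion_closedBall one_lt_rank_orthogonal_span_axisPoint (fun n ↦ ?_) hr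
  refine Submodule.mem_span_singleton.2 ⟨s n, ?_⟩
  ext i
  simp [axisPoint]

/-- The points `(s, 0, 0)`, `s ∈ S`, in increasing order of `s`; meaningful only for infinite `S`,
since `Nat.nth` takes the junk value `0` beyond the size of a finite set. -/
noncomputable def axisCentre (S : Set ℕ) (n : ℕ) : EuclideanSpace ℝ (Fin 3) :=
  axisPoint (Nat.nth (· ∈ S) n)

variable {S : Set ℕ}

theorem range_axisCentre (hS : S.Infinite) :
    Set.range (axisCentre S) = (fun s : ℕ ↦ axisPoint s) '' S := by
  have range_nth : Set.range (Nat.nth (· ∈ S)) = S := Nat.range_nth_of_infinite hS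
  conv_rhs => rw [← range_nth, ← Set.range_comp]
  rfl

theorem one_le_dist_axisCentre (hS : S.Infinite) {n m : ℕ} (hnm : n ≠ m) :
    1 ≤ dist (axisCentre S n) (axisCentre S m) := by
  have nth_ne : Nat.nth (· ∈ S) n ≠ Nat.nth (· ∈ S) m := (Nat.nth_injective hS).ne hnm
  have : (1 : ℤ) ≤ |(Nat.nth (· ∈ S) n : ℤ) - Nat.nth (· ∈ S) m| := Int.one_le_abs (by lia)
  rw [axisCentre, axisCentre, dist_axisPoint]
  exact_mod_cast this

theorem separated_axisCentre (hS : S.Infinite) : Separated (axisCentre S) :=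
  ⟨1 / 2, one_half_pos, fun n m hnm ↦ by simpa using one_le_dist_axisCentre hS hnm⟩

theorem isBallConfiguration_axisCentre (hS : S.Infinite) (hS0 : 0 ∉ S) {ρ : ℝ} (hρ : 0 < ρ)
    (hρ_lt : ρ < 1 / 2) : IsBallConfiguration (axisCentre S) fun _ ↦ ρ where
  radius_pos _ := hρ
  disjoint n m hnm := Metric.closedBall_disjoint_closedBall <| by
    linarith [one_le_dist_axisCentre hS hnm]
  isOpen_region := (separated_axisCentre hS).isOpen_complementRegion hρ.le
  isConnected_region := isConnected_complementRegion_axisPoint _ ⟨ρ, by simp [upperBounds]⟩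
  zero_mem_region := by
    have one_le_nth n : 1 ≤ Nat.nth (· ∈ S) n :=
      Nat.one_le_iff_ne_zero.2 fun h ↦ hS0 (h ▸ Nat.nth_mem_of_infinite hS n)
    simp only [complementRegion, Set.mem_compl_iff, Set.mem_iUnion, Metric.mem_closedBall,
      dist_zero_left, not_exists, not_le]
    intro n
    rw [axisCentre, norm_axisPoint, Nat.abs_cast]
    have : (1 : ℝ) ≤ Nat.nth (· ∈ S) n := by exact_mod_cast one_le_nth n
    linarith

theorem tendsto_sum_div_norm_axisCentre (hS : S.Infinite)
    (hsum : ¬ Summable (S.indicator fun s ↦ (s : ℝ)⁻¹)) {ρ : ℝ} (hρ : 0 < ρ) :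
    Tendsto (fun N ↦ ∑ n ∈ Finset.range N, ρ / ‖axisCentre S n‖) atTop atTop := by
  rw [← not_summable_iff_tendsto_nat_atTop_of_nonneg fun n ↦ by positivity]
  simp only [div_eq_mul_inv, summable_mul_left_iff hρ.ne']
  contrapose! hsum
  have range_nth : Set.range (Nat.nth (· ∈ S)) = S := Nat.range_nth_of_infinite hS
  have nth_injective : (Nat.nth (· ∈ S)).Injective := Nat.nth_injective hS
  have nth_mem n : Nat.nth (· ∈ S) n ∈ S := Nat.nth_mem_of_infinite hS n
  refine (nth_injective.summable_iff fun s hs ↦ ?_).1 (hsum.congr fun n ↦ ?_)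
  · exact Set.indicator_of_notMem (range_nth ▸ hs) _
  · simp [axisCentre, norm_axisPoint, nth_mem]

theorem not_summable_indicator_inv_of_frequently_Ioc_subset
    (hS : ∃ᶠ m in atTop, Set.Ioc m (2 * m) ⊆ S) :
    ¬ Summable (S.indicator fun s ↦ (s : ℝ)⁻¹) := by
  intro hsum
  obtain ⟨t, ht⟩ := summable_iff_vanishing_norm.1 hsum (1 / 2) one_half_pos
  obtain ⟨b, hb⟩ := t.bddAbove
  obtain ⟨m, hbm, hm⟩ := frequently_atTop.1 hS (b + 1)
  have block_disjoint : Disjoint (Finset.Ioc m (2 * m)) t :=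
    Finset.disjoint_left.2 fun s hs hst ↦ by
      have := hb hst
      have := (Finset.mem_Ioc.1 hs).1
      lia
  have m_pos : (0 : ℝ) < m := by exact_mod_cast (by lia : 0 < m)
  refine (ht _ block_disjoint).not_ge ((le_abs_self _).trans' ?_)
  calc (1 / 2 : ℝ) = ∑ s ∈ Finset.Ioc m (2 * m), (2 * m : ℝ)⁻¹ := by
        rw [Finset.sum_const, Nat.card_Ioc, nsmul_eq_mul, two_mul, Nat.add_sub_cancel]
        field_simp
    _ ≤ ∑ s ∈ Finset.Ioc m (2 * m), S.indicator (fun s ↦ (s : ℝ)⁻¹) s := by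
        refine Finset.sum_le_sum fun s hs ↦ ?_
        obtain ⟨hms, hsm⟩ := Finset.mem_Ioc.1 hs
        rw [Set.indicator_of_mem (hm ⟨hms, hsm⟩)]
        have : (0 : ℝ) < s := m_pos.trans (by exact_mod_cast hms)
        gcongr
        exact_mod_cast hsm

end AxisConfiguration

section StringPotential

theorem stringCentres_eq_image (m k : ℕ) :
    stringCentres m k = (fun s : ℕ ↦ axisPoint s) '' Set.Ioc m (m + 2 * k) := by
  ext x
  constructor
  · rintro ⟨i, hi, hik, rfl⟩
    exact ⟨m + i, ⟨by lia, by lia⟩, by simp only [axisPoint, Nat.cast_add]⟩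
  · rintro ⟨s, ⟨hms, hsm⟩, rfl⟩
    refine ⟨s - m, by lia, by lia, ?_⟩
    simp only [axisPoint, Nat.cast_sub hms.le, add_sub_cancel]

theorem harmonic_le_sum_inv_abs_sub_add_one {m n k s : ℕ} (hmn : m + 2 * k ≤ n)
    (hs : s ∈ Finset.Ioc m n) :
    (harmonic k : ℝ) ≤ ∑ t ∈ Finset.Ioc m n, (|(s : ℝ) - t| + 1)⁻¹ := by
  rw [Finset.mem_Ioc] at hs
  obtain ⟨g, g_inj, g_mem, g_dist⟩ : ∃ g : ℕ → ℕ, Set.InjOn g (Finset.range k) ∧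
      (∀ i ∈ Finset.range k, g i ∈ Finset.Ioc m n) ∧
      ∀ i ∈ Finset.range k, |(s : ℝ) - g i| = i := by
    simp only [Set.InjOn, Finset.coe_range, Set.mem_Iio, Finset.mem_range, Finset.mem_Ioc]
    -- Of the two halves of the string around `s`, one contains at least `k` of its points.
    rcases le_total (s + k) n with hsk | hsk
    · exact ⟨fun i ↦ s + i, by lia, by lia, by simp⟩
    · refine ⟨fun i ↦ s - i, by lia, by lia, fun i hi ↦ ?_⟩
      rw [Nat.cast_sub (by lia), sub_sub_cancel, Nat.abs_cast]
  calc (harmonic k : ℝ) = ∑ i ∈ Finset.range k, (|(s : ℝ) - g i| + 1)⁻¹ := by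
        rw [harmonic, Rat.cast_sum]
        refine Finset.sum_congr rfl fun i hi ↦ ?_
        rw [g_dist i hi]
        push_cast
        rfl
    _ = ∑ t ∈ (Finset.range k).image g, (|(s : ℝ) - t| + 1)⁻¹ :=
        (Finset.sum_image (f := fun t : ℕ ↦ (|(s : ℝ) - t| + 1)⁻¹) g_inj).symm
    _ ≤ ∑ t ∈ Finset.Ioc m n, (|(s : ℝ) - t| + 1)⁻¹ :=
        Finset.sum_le_sum_of_subset_of_nonneg (Finset.image_subset_iff.2 g_mem)
          fun t _ _ ↦ by positivity

/-- The Newtonian potential of unit charges at the points of `stringCentres m k`. -/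
noncomputable def stringPotential (m k : ℕ) (x : EuclideanSpace ℝ (Fin 3)) : ℝ≥0∞ :=
  ∑ s ∈ Finset.Ioc m (m + 2 * k), ‖x - axisPoint s‖ₑ⁻¹

theorem continuous_stringPotential (m k : ℕ) : Continuous (stringPotential m k) := by
  unfold stringPotential
  fun_prop

theorem gaussianExcessive_stringPotential (m k : ℕ) :
    GaussianExcessive (stringPotential m k) :=
  .sum (fun s _ ↦ gaussianExcessive_inv_enorm.comp_sub_right (axisPoint s))
    fun s _ ↦ by fun_prop

theorem stringPotential_zero_le (m k : ℕ) : stringPotential m k 0 ≤ (2 * k : ℕ) / m := by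
  refine (Finset.sum_le_card_nsmul _ _ (m : ℝ≥0∞)⁻¹ fun s hs ↦ ?_).trans_eq ?_
  · rw [zero_sub, enorm_neg, ← ofReal_norm, norm_axisPoint, Nat.abs_cast, ENNReal.ofReal_natCast]
    gcongr
    exact (Finset.mem_Ioc.1 hs).1.le
  · rw [Nat.card_Ioc, nsmul_eq_mul, Nat.add_sub_cancel_left, div_eq_mul_inv]

theorem harmonic_le_stringPotential {m k : ℕ} {p x : EuclideanSpace ℝ (Fin 3)}
    (hp : p ∈ stringCentres m k) (hx : dist x p ≤ 1) :
    ENNReal.ofReal (harmonic k) ≤ stringPotential m k x := by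
  rw [stringCentres_eq_image, ← Finset.coe_Ioc] at hp
  obtain ⟨s, hs, rfl⟩ := hp
  calc ENNReal.ofReal (harmonic k)
      ≤ ENNReal.ofReal (∑ t ∈ Finset.Ioc m (m + 2 * k), (|(s : ℝ) - t| + 1)⁻¹) :=
        ENNReal.ofReal_le_ofReal (harmonic_le_sum_inv_abs_sub_add_one le_rfl hs)
    _ = ∑ t ∈ Finset.Ioc m (m + 2 * k), ENNReal.ofReal ((|(s : ℝ) - t| + 1)⁻¹) :=
        ENNReal.ofReal_sum_of_nonneg fun t _ ↦ by positivity
    _ ≤ stringPotential m k x := by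
        refine Finset.sum_le_sum fun t _ ↦ ?_
        rw [ENNReal.ofReal_inv_of_pos (by positivity), ← ofReal_norm, ← dist_eq_norm]
        gcongr
        linarith [dist_triangle x (axisPoint s) (axisPoint t), dist_axisPoint s t]

theorem avoidable_of_stringPotential_weights {m k : ℕ → ℕ} {w : ℕ → ℝ≥0∞} (hw : ∀ j, w j ≠ ⊤)
    (hsmall : ∑' j, w j * ((2 * k j : ℕ) / m j) < 1)
    (hlarge : ∀ j, 1 < w j * ENNReal.ofReal (harmonic (k j)))
    {c : ℕ → EuclideanSpace ℝ (Fin 3)} (hc : ∀ n, c n ∈ ⋃ j, stringCentres (m j) (k j))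
    {r : ℕ → ℝ} (hr : ∀ n, r n ≤ 1) : Avoidable.{u} c r := by
  refine avoidable_of_gaussianExcessive (f := fun x ↦ ∑' j, w j * stringPotential (m j) (k j) x)
    (a := 1) ?_ ?_ ?_ fun n x hx ↦ ?_
  · exact lowerSemicontinuous_tsum fun j ↦
      ((ENNReal.continuous_const_mul (hw j)).comp
        (continuous_stringPotential _ _)).lowerSemicontinuous
  · exact .tsum (fun j ↦ (gaussianExcessive_stringPotential _ _).const_mul (hw j))
      fun j ↦ (continuous_stringPotential _ _).measurable.const_mul _
  · exact hsmall.trans_le' (ENNReal.tsum_le_tsum fun j ↦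
      mul_le_mul_right (stringPotential_zero_le _ _) _)
  · obtain ⟨j, hj⟩ := Set.mem_iUnion.1 (hc n)
    calc 1 < w j * ENNReal.ofReal (harmonic (k j)) := hlarge j
      _ ≤ w j * stringPotential (m j) (k j) x :=
        mul_le_mul_right (harmonic_le_stringPotential hj (hx.trans (hr n))) _
      _ ≤ ∑' j, w j * stringPotential (m j) (k j) x := ENNReal.le_tsum j

end StringPotential

section StringOffset

/-- The offset `m_j`, and also half the length `k_j`, of the `j`-th string, doubly exponential so
that the sum of the reciprocals of `log k_j` is small. -/
def stringOffset (j : ℕ) : ℕ := 2 ^ 2 ^ (j + 4)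

theorem stringOffset_pos (j : ℕ) : 0 < stringOffset j := by
  unfold stringOffset
  positivity

theorem four_mul_stringOffset_lt (j : ℕ) : 4 * stringOffset j < stringOffset (j + 1) := by
  have square : stringOffset (j + 1) = stringOffset j * stringOffset j := by
    rw [stringOffset, stringOffset, ← pow_add, ← two_mul, ← pow_succ']
  have four_lt : 4 < stringOffset j := calc
    4 < 2 ^ 2 ^ 4 := by norm_num
    _ ≤ stringOffset j := by unfold stringOffset; gcongr <;> lia
  rw [square]
  exact Nat.mul_lt_mul_of_pos_right four_lt (stringOffset_pos j)

theorem strictMono_stringOffset : StrictMono stringOffset :=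
  strictMono_nat_of_lt_succ fun j ↦ by
    have := four_mul_stringOffset_lt j
    lia

theorem two_pow_lt_harmonic_stringOffset (j : ℕ) :
    2 ^ (j + 3) < (harmonic (stringOffset j) : ℝ) :=
  calc (2 : ℝ) ^ (j + 3) = 2 ^ (j + 4) * (1 / 2) := by ring
    _ < 2 ^ (j + 4) * Real.log 2 := by
      gcongr
      exact Real.log_two_gt_d9.trans' (by norm_num)
    _ = Real.log (stringOffset j : ℝ) := by
      rw [stringOffset, Nat.cast_pow, Real.log_pow, Nat.cast_pow, Nat.cast_ofNat]
    _ ≤ Real.log ((stringOffset j + 1 : ℕ) : ℝ) := by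
      have := stringOffset_pos j
      gcongr
      lia
    _ ≤ harmonic (stringOffset j) := log_add_one_le_harmonic _

theorem avoidable_of_mem_stringCentres_stringOffset {c : ℕ → EuclideanSpace ℝ (Fin 3)}
    (hc : ∀ n, c n ∈ ⋃ j, stringCentres (stringOffset j) (stringOffset j)) {r : ℕ → ℝ}
    (hr : ∀ n, r n ≤ 1) : Avoidable.{u} c r := by
  refine avoidable_of_stringPotential_weights (w := fun j ↦ 2⁻¹ ^ (j + 3))
    (fun j ↦ by finiteness) ?_ (fun j ↦ ?_) hc hr
  · have term_eq (j : ℕ) : (2⁻¹ : ℝ≥0∞) ^ (j + 3) *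
        ((2 * stringOffset j : ℕ) / stringOffset j) = 2⁻¹ ^ 2 * 2⁻¹ ^ j := by
      have offset_ne_zero : (stringOffset j : ℝ≥0∞) ≠ 0 := by
        exact_mod_cast (stringOffset_pos j).ne'
      rw [Nat.cast_mul, ENNReal.mul_div_cancel_right offset_ne_zero (by finiteness), Nat.cast_ofNat,
        pow_succ, mul_assoc, ENNReal.inv_mul_cancel two_ne_zero ENNReal.ofNat_ne_top, mul_one,
        pow_add, mul_comm]
    rw [tsum_congr term_eq, ENNReal.tsum_mul_left, ENNReal.tsum_geometric,
      ENNReal.one_sub_inv_two, inv_inv, sq, mul_assoc,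
      ENNReal.inv_mul_cancel two_ne_zero ENNReal.ofNat_ne_top, mul_one]
    exact ENNReal.inv_lt_one.2 ENNReal.one_lt_two
  · rw [← ENNReal.inv_pow, mul_comm, ← div_eq_mul_inv,
      ENNReal.lt_div_iff_mul_lt (by simp) (by simp), one_mul,
      ENNReal.lt_ofReal_iff_toReal_lt (by finiteness)]
    simpa using two_pow_lt_harmonic_stringOffset j

/-- The first coordinates of the centres of all the strings. -/
def stringIndices : Set ℕ :=
  ⋃ j, Set.Ioc (stringOffset j) (stringOffset j + 2 * stringOffset j)

theorem image_axisPoint_stringIndices :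
    (fun s : ℕ ↦ axisPoint s) '' stringIndices =
      ⋃ j, stringCentres (stringOffset j) (stringOffset j) := by
  simp only [stringIndices, Set.image_iUnion, stringCentres_eq_image]

theorem zero_notMem_stringIndices : 0 ∉ stringIndices := by
  simp [stringIndices]

theorem infinite_stringIndices : stringIndices.Infinite :=
  Set.infinite_of_forall_exists_gt fun n ↦ by
    have := stringOffset_pos n
    exact ⟨stringOffset n + 1, Set.mem_iUnion.2 ⟨n, by lia, by lia⟩,
      Nat.lt_succ_of_le (strictMono_stringOffset.le_apply)⟩

theorem not_summable_indicator_inv_stringIndices :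
    ¬ Summable (stringIndices.indicator fun s ↦ (s : ℝ)⁻¹) := by
  refine not_summable_indicator_inv_of_frequently_Ioc_subset <|
    strictMono_stringOffset.tendsto_atTop.frequently (.of_forall fun j ↦ ?_)
  exact (Set.Ioc_subset_Ioc_right (by lia)).trans (Set.subset_iUnion
    (fun j ↦ Set.Ioc (stringOffset j) (stringOffset j + 2 * stringOffset j)) j)

end StringOffset

theorem mainTheorem5 :
    ∃ (c : ℕ → EuclideanSpace ℝ (Fin 3)) (r : ℕ → ℝ),
      IsBallConfiguration c r ∧
      Avoidable.{u} c r ∧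
      Separated c ∧
      Tendsto (fun N : ℕ => ∑ n ∈ Finset.range N, r n / ‖c n‖) atTop atTop ∧
      (∀ n, r n = 1 / 4) ∧
      ∃ m k : ℕ → ℕ,
        (∀ j, 1 ≤ k j) ∧
        (∀ j, m j + 2 * k j < m (j + 1)) ∧
        Set.range c = ⋃ j, stringCentres (m j) (k j) := by
  have infinite := infinite_stringIndices
  have range_eq := (range_axisCentre infinite).trans image_axisPoint_stringIndices
  refine ⟨axisCentre stringIndices, fun _ ↦ 1 / 4, ?_, ?_, separated_axisCentre infinite, ?_,
    fun _ ↦ rfl, stringOffset, stringOffset, stringOffset_pos, fun j ↦ ?_, range_eq⟩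
  · exact isBallConfiguration_axisCentre infinite zero_notMem_stringIndices (by norm_num)
      (by norm_num)
  · exact avoidable_of_mem_stringCentres_stringOffset
      (fun n ↦ range_eq ▸ Set.mem_range_self n) fun _ ↦ by norm_num
  · exact tendsto_sum_div_norm_axisCentre infinite not_summable_indicator_inv_stringIndices
      (by norm_num)
  · have := four_mul_stringOffset_lt j
    lia
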